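/- Let $w=a_1\cdots a_n$ be a word over an alphabet of letters $A,B,\dots$ and their inverses $A^{-1},B^{-1},\dots$ (inverses are not cancelled; $A$ and $A^{-1}$ count as the same letter), and give each letter a real value $\ge 0$, denoted by the same symbol. A non-crossing forest over a word is a forest $F$ whose vertices are the positions of the word, placed in order around a circle, such that all vertices of a component have the same letter and different components do not cross (that is, the components form a non-crossing partition). For such $F$ with trees $T_1,\dots,T_m$, where $T_k$ has letter $x_k$ and $|T_k|$ vertices, let $s(T_k)$ be the number of edges of $T_k$ that connect two $x_k$'s or two $x_k^{-1}$'s, let $s(F)=\sum_k s(T_k)$, and put $$q(F)=\prod_{k=1}^m(-1)^{s(T_k)}\frac{x_k^{|T_k|-1}}{(|T_k|-1)!},\qquad q(w)=\sum_F q(F),$$ the sum being over all non-crossing forests over $w$. *Forest polynomial.* For $J\ge 1$ let $w_J$ be the word obtained from $w$ by replacing each $A$ by $A_1\cdots A_J$ and each $A^{-1}$ by $A_J^{-1}\cdots A_1^{-1}$, and likewise for the other letters, with new distinct letters $A_i,B_i,\dots$. Then $$p(w)=\lim_{J\to\infty} q(w_J)\Big|_{A_i=A/J,\ B_i=B/J,\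 \dots}.$$ *Poisson forest polynomial.* Let $n_A,n_B,\dots$ be independent Poisson random variables with parameters $A,B,\dots$, and let $\varphi(w)$ be the random word obtained from $w$ by replacing each $A$ by $A_1\cdots A_{n_A}$ and each $A^{-1}$ by $A_{n_A}^{-1}\cdots A_1^{-1}$, and likewise for the other letters. For a word $v$ let $\hat q(v)=\sum_F(-1)^{s(F)}$, the sum being over the non-crossing forests $F$ over $v$ any two different edges of which have different letters. Then $$\hat p(w)=\mathbb E\,\hat q(\varphi(w)).$$ **Proposition.** For every word $w$ and all values $\ge 0$ of the letters, the limit defining $p(w)$ exists, $\hat q(\varphi(w))$ is integrable, and $\hat p(w)=p(w)$. -/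

import Mathlib

open Filter Topology MeasureTheory ProbabilityTheory
open scoped NNReal Nat

/-! A word over the alphabet `β` is a list of pairs `(x, ε)`: the pair `(x, true)` is the letter `x`
and `(x, false)` is its inverse `x⁻¹`. Both `x` and `x⁻¹` have the letter `x`. -/

namespace ForestPoly

/-- The letter at position `i` of a word, where `x` and `x⁻¹` count as the same letter. -/
def letterAt {β : Type*} (w : List (β × Bool)) (i : Fin w.length) : β := (w.get i).1

/-- The exponent at position `i`: `true` for `x`, `false` for `x⁻¹`. -/
def signAt {β : Type*} (w : List (β × Bool)) (i : Fin w.length) : Bool := (w.get i).2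

/-- `F` is a non-crossing forest over the word `w`; its vertices are the positions of `w`, placed in
order around a circle. -/
structure IsNoncrossingForest {β : Type*} (w : List (β × Bool))
    (F : SimpleGraph (Fin w.length)) : Prop where
  /-- `F` has no cycles. -/
  acyclic : F.IsAcyclic
  /-- In each component every vertex has the same letter. -/
  sameLetter : ∀ i j, F.Reachable i j → letterAt w i = letterAt w j
  /-- Different components do not cross: the components form a non-crossing partition. -/
  noncrossing : ∀ i j k l, i < j → j < k → k < l →
    F.Reachable i k → F.Reachable j l → F.Reachable i j

open Classical in
/-- The finite set of all non-crossing forests over `w`. -/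
noncomputable def noncrossingForests {β : Type*} (w : List (β × Bool)) :
    Finset (SimpleGraph (Fin w.length)) :=
  Finset.univ.filter (IsNoncrossingForest w)

/-- The edges of `F` that connect two copies of `x` or two copies of `x⁻¹`. -/
def equalSignEdges {β : Type*} (w : List (β × Bool)) (F : SimpleGraph (Fin w.length)) :
    Set (Sym2 (Fin w.length)) :=
  {e | e ∈ F.edgeSet ∧ ∀ u ∈ e, ∀ v ∈ e, signAt w u = signAt w v}

/-- The common letter of the vertices of a component of a non-crossing forest. -/
noncomputable def componentLetter {β : Type*} (w : List (β × Bool))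
    (F : SimpleGraph (Fin w.length)) (T : F.ConnectedComponent) : β :=
  letterAt w T.nonempty_supp.some

/-- The value of the factor of `q(F)` belonging to the tree `T`, at the values `x` of the letters:
`(-1) ^ s(T) * x_T ^ (|T| - 1) / (|T| - 1)!`. Here `|T| ≥ 1` is the number of vertices of `T`. -/
noncomputable def treeWeight {β : Type*} (w : List (β × Bool)) (F : SimpleGraph (Fin w.length))
    (x : β → ℝ) (T : F.ConnectedComponent) : ℝ :=
  (-1) ^ {e | e ∈ equalSignEdges w F ∧ ∀ v ∈ e, v ∈ T.supp}.ncard *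
    (x (componentLetter w F T) ^ (T.supp.ncard - 1) / ((T.supp.ncard - 1)! : ℝ))

open Classical in
/-- The value of `q(F)` at `x`, the product over all trees of `F`. -/
noncomputable def forestWeight {β : Type*} (w : List (β × Bool)) (F : SimpleGraph (Fin w.length))
    (x : β → ℝ) : ℝ :=
  ∏ T : F.ConnectedComponent, treeWeight w F x T

/-- The value of the polynomial `q(w)` at `x`. -/
noncomputable def q {β : Type*} (w : List (β × Bool)) (x : β → ℝ) : ℝ :=
  ∑ F ∈ noncrossingForests w, forestWeight w F x

/-- Splitting of one letter: `a` becomes `a_0 a_1 … a_(N a - 1)`, and `a⁻¹` becomes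
`a_(N a - 1)⁻¹ … a_1⁻¹ a_0⁻¹`, where `a_i` is the letter `(a, i)` of the new alphabet. -/
def splitLetter {α : Type*} (N : α → ℕ) : α × Bool → List ((α × ℕ) × Bool)
  | (a, true) => (List.range (N a)).map fun i => ((a, i), true)
  | (a, false) => ((List.range (N a)).map fun i => ((a, i), false)).reverse

/-- The word obtained from `w` by splitting every letter `a^{±1}` into `N a` pieces. -/
def splitWord {α : Type*} (N : α → ℕ) (w : List (α × Bool)) : List ((α × ℕ) × Bool) :=
  w.flatMap (splitLetter N)

/-- `q(w_J)` evaluated at `a / J` for every piece of every letter `a`, where each letter has been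
split into `J` pieces. -/
noncomputable def splitForestSum {α : Type*} (w : List (α × Bool)) (x : α → ℝ) (J : ℕ) : ℝ :=
  q (splitWord (fun _ => J) w) (fun b => x b.1 / (J : ℝ))

/-- The forest polynomial `p(w)`, as a function of the values of the letters. -/
noncomputable def forestPolynomial {α : Type*} (w : List (α × Bool)) (x : α → ℝ) : ℝ :=
  limUnder atTop (splitForestSum w x)

/-- All edges of `F` have different letters. -/
def HasDistinctEdgeLetters {β : Type*} (w : List (β × Bool))
    (F : SimpleGraph (Fin w.length)) : Prop :=
  ∀ e ∈ F.edgeSet, ∀ e' ∈ F.edgeSet, ∀ u ∈ e, ∀ u' ∈ e', letterAt w u = letterAt w u' → e = e'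

open Classical in
/-- The signed count of the non-crossing forests over `w` all of whose edges have different letters,
each counted with the sign `(-1) ^ s(F)`. -/
noncomputable def qHat {β : Type*} (w : List (β × Bool)) : ℝ :=
  ∑ F ∈ (noncrossingForests w).filter (HasDistinctEdgeLetters w),
    (-1 : ℝ) ^ (equalSignEdges w F).ncard

/-- The joint law of independent Poisson variables `n_a`, one for each letter `a`, with
parameters `t a`. -/
noncomputable def poissonLaw {α : Type*} (t : α → ℝ≥0) : Measure (α → ℕ) :=
  Measure.infinitePi fun a => poissonMeasure (t a)

/-- The Poisson forest polynomial `p̂(w)`, as a function of the values of the letters. -/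
noncomputable def poissonForestPolynomial {α : Type*} (w : List (α × Bool)) (t : α → ℝ≥0) : ℝ :=
  ∫ N, qHat (splitWord N w) ∂(poissonLaw t)

end ForestPoly

/-! The sum `q(w_J)` splits according to whether the edges of a forest have pairwise different
letters.

If they do, every tree has at most one edge, all factorials equal 1, and the weight is a sign times
the product of `A / J` over the edges. Select each piece `A_i` independently with probability `A /
J`. The product is then the probability that all edge letters are selected, so summing over forests
gives the expected signed count of such forests on the selected subword. Up to renaming letters that
subword is `w` split into as many pieces as were selected. This part of `q(w_J)` is therefore
exactly the mean of `qHat` with binomial multiplicities (`sum_hasDistinctEdgeLetters_eq`).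

As `J → ∞` the binomial weights tend to the Poisson weights. Since `qHat` grows at most
exponentially in the multiplicities (`abs_qHat_splitWord_le`), dominated convergence gives the
Poisson mean (`tendsto_sum_binomialWeight`); the same bound gives integrability.

Forests with two edges of one letter contribute `O(1 / J)`: there are `O(J)` such pairs of edges,
each costs `O(1 / J ^ 2)`, and the remaining edges contribute a bounded factor
(`tendsto_sum_not_hasDistinctEdgeLetters`). -/

namespace ForestPoly

/-! ### Forest weights as edge products -/

section Weights

variable {β : Type*} {w : List (β × Bool)} {F : SimpleGraph (Fin w.length)} {x : β → ℝ}

/-- The letter at one of the endpoints of a pair of positions. -/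
noncomputable def edgeLetter (w : List (β × Bool)) (e : Sym2 (Fin w.length)) : β :=
  letterAt w (Quot.out e).1

lemma neg_one_pow_ncard_eq_prod {ι : Type*} (s : Finset ι) (P : ι → Prop) [DecidablePred P] :
    (-1 : ℝ) ^ {e | e ∈ s ∧ P e}.ncard = ∏ e ∈ s, if P e then -1 else 1 := by
  have : {e | e ∈ s ∧ P e} = ((s.filter P : Finset ι) : Set ι) := by ext; simp
  rw [this, Set.ncard_coe_finset, Finset.prod_ite]
  simp

lemma out_fst_mem (e : Sym2 (Fin w.length)) : (Quot.out e).1 ∈ e := Sym2.out_fst_mem e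

lemma reachable_of_mem_edge {e : Sym2 (Fin w.length)} (he : e ∈ F.edgeSet)
    {u v : Fin w.length} (hu : u ∈ e) (hv : v ∈ e) : F.Reachable u v := by
  induction e with
  | h a b =>
    have hab : F.Adj a b := he
    rw [Sym2.mem_iff] at hu hv
    rcases hu with rfl | rfl <;> rcases hv with rfl | rfl
    · rfl
    · exact hab.reachable
    · exact hab.symm.reachable
    · rfl

lemma IsNoncrossingForest.edgeLetter_eq (hF : IsNoncrossingForest w F)
    {e : Sym2 (Fin w.length)} (he : e ∈ F.edgeSet) {u : Fin w.length} (hu : u ∈ e) :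
    edgeLetter w e = letterAt w u :=
  hF.sameLetter _ _ (reachable_of_mem_edge he (out_fst_mem e) hu)

/-- The component containing an endpoint of a pair of positions. -/
noncomputable def edgeComponent (F : SimpleGraph (Fin w.length)) (e : Sym2 (Fin w.length)) :
    F.ConnectedComponent :=
  F.connectedComponentMk (Quot.out e).1

lemma mem_supp_iff_edgeComponent_eq {e : Sym2 (Fin w.length)} (he : e ∈ F.edgeSet)
    {u : Fin w.length} (hu : u ∈ e) (T : F.ConnectedComponent) :
    u ∈ T.supp ↔ edgeComponent F e = T := by
  have h := reachable_of_mem_edge he hu (out_fst_mem e)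
  rw [SimpleGraph.ConnectedComponent.mem_supp_iff, edgeComponent,
    SimpleGraph.ConnectedComponent.eq.2 h]

lemma forall_mem_supp_iff {e : Sym2 (Fin w.length)} (he : e ∈ F.edgeSet)
    (T : F.ConnectedComponent) : (∀ v ∈ e, v ∈ T.supp) ↔ edgeComponent F e = T :=
  ⟨fun h => (mem_supp_iff_edgeComponent_eq he (out_fst_mem e) T).1 (h _ (out_fst_mem e)),
    fun h _ hv => (mem_supp_iff_edgeComponent_eq he hv T).2 h⟩

-- The edges of `F` inside `T` are the images of the edges of the induced graph on `T`, which is a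
-- tree. This turns the exponent and the factorial in `treeWeight` into edge counts.
open Classical in
lemma card_edges_component (hF : F.IsAcyclic) (T : F.ConnectedComponent) :
    (F.edgeFinset.filter fun e => edgeComponent F e = T).card = T.supp.ncard - 1 := by
  have h := (hF.isTree_connectedComponent T).card_edgeFinset
  have h2 : Fintype.card T = T.supp.ncard := by
    rw [Set.ncard_eq_toFinset_card', Set.toFinset_card]
    exact Fintype.card_congr (Equiv.refl _)
  have h3 : (F.edgeFinset.filter fun e => edgeComponent F e = T) =
      T.toSimpleGraph.edgeFinset.image (Sym2.map Subtype.val) := by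
    ext e
    induction e with
    | h a b =>
      simp only [Finset.mem_filter, SimpleGraph.mem_edgeFinset, Finset.mem_image]
      constructor
      · rintro ⟨he, hT⟩
        have := (forall_mem_supp_iff he T).2 hT
        refine ⟨s(⟨a, this a (by simp)⟩, ⟨b, this b (by simp)⟩), ?_, by simp⟩
        exact he
      · rintro ⟨e', he', h⟩
        induction e' with
        | h a' b' =>
          have he : s(a, b) ∈ F.edgeSet := by
            rw [← h]; exact he'
          refine ⟨he, (forall_mem_supp_iff he T).1 ?_⟩
          rw [← h]
          intro v hv
          simp only [Sym2.map_mk, Sym2.mem_iff] at hv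
          rcases hv with rfl | rfl
          · exact a'.2
          · exact b'.2
  rw [h3, Finset.card_image_of_injective _ (Sym2.map.injective Subtype.val_injective)]
  omega

lemma IsNoncrossingForest.componentLetter_eq (hF : IsNoncrossingForest w F)
    (e : Sym2 (Fin w.length)) :
    componentLetter w F (edgeComponent F e) = edgeLetter w e := by
  refine hF.sameLetter _ _ ?_
  have := (edgeComponent F e).nonempty_supp.some_mem
  rw [SimpleGraph.ConnectedComponent.mem_supp_iff] at this
  exact SimpleGraph.ConnectedComponent.exact this

open Classical in
/-- The weight of a non-crossing forest as a product over its edges. -/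
lemma IsNoncrossingForest.forestWeight_eq (hF : IsNoncrossingForest w F) :
    forestWeight w F x = (-1) ^ (equalSignEdges w F).ncard *
      (∏ e ∈ F.edgeFinset, x (edgeLetter w e)) /
        ∏ T : F.ConnectedComponent, ((T.supp.ncard - 1)! : ℝ) := by
  let P : Sym2 (Fin w.length) → Prop := fun e => ∀ u ∈ e, ∀ v ∈ e, signAt w u = signAt w v
  have h1 : (-1 : ℝ) ^ (equalSignEdges w F).ncard =
      ∏ e ∈ F.edgeFinset, if P e then -1 else 1 := by
    rw [← neg_one_pow_ncard_eq_prod]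
    simp [equalSignEdges, P]
  have h2 (T : F.ConnectedComponent) : treeWeight w F x T =
      (∏ e ∈ F.edgeFinset.filter (fun e => edgeComponent F e = T),
        ((if P e then -1 else 1) * x (edgeLetter w e))) / ((T.supp.ncard - 1)! : ℝ) := by
    rw [treeWeight, Finset.prod_mul_distrib, ← mul_div_assoc]
    congr 2
    · rw [← neg_one_pow_ncard_eq_prod]
      congr 2
      ext e
      simp only [Set.mem_ofPred_eq, equalSignEdges, Finset.mem_filter, SimpleGraph.mem_edgeFinset]
      constructor
      · rintro ⟨⟨he, hp⟩, hT⟩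
        exact ⟨⟨he, (forall_mem_supp_iff he T).1 hT⟩, hp⟩
      · rintro ⟨⟨he, hT⟩, hp⟩
        exact ⟨⟨he, hp⟩, (forall_mem_supp_iff he T).2 hT⟩
    · rw [← card_edges_component hF.acyclic, ← Finset.prod_const]
      refine Finset.prod_congr rfl fun e he => ?_
      simp only [Finset.mem_filter, SimpleGraph.mem_edgeFinset] at he
      rw [← he.2, hF.componentLetter_eq]
  simp_rw [forestWeight, h2]
  rw [Finset.prod_div_distrib, h1, ← Finset.prod_mul_distrib]
  congr 1
  convert Finset.prod_fiberwise F.edgeFinset (edgeComponent F)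
    (fun e => (if P e then (-1 : ℝ) else 1) * x (edgeLetter w e))

open Classical in
lemma IsNoncrossingForest.abs_forestWeight_le (hF : IsNoncrossingForest w F) (hx : ∀ b, 0 ≤ x b) :
    |forestWeight w F x| ≤ ∏ e ∈ F.edgeFinset, x (edgeLetter w e) := by
  have h0 : 0 ≤ ∏ e ∈ F.edgeFinset, x (edgeLetter w e) := Finset.prod_nonneg fun _ _ => hx _
  have h1 : (1 : ℝ) ≤ ∏ T : F.ConnectedComponent, ((T.supp.ncard - 1)! : ℝ) :=
    Finset.prod_induction _ (fun r : ℝ => 1 ≤ r) (fun _ _ => one_le_mul_of_one_le_of_one_le) le_rfl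
      fun T _ => by exact_mod_cast Nat.one_le_iff_ne_zero.2 (Nat.factorial_ne_zero _)
  rw [hF.forestWeight_eq, abs_div, abs_mul, abs_pow, abs_neg, abs_one, one_pow, one_mul,
    abs_of_nonneg h0, abs_of_pos (by linarith)]
  exact div_le_self h0 h1

-- Two edges in one tree would share a letter, so each tree has at most one edge and every factorial
-- is `0!` or `1!`.
open Classical in
lemma IsNoncrossingForest.forestWeight_of_hasDistinctEdgeLetters (hF : IsNoncrossingForest w F)
    (hd : HasDistinctEdgeLetters w F) :
    forestWeight w F x = (-1) ^ (equalSignEdges w F).ncard *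
      ∏ e ∈ F.edgeFinset, x (edgeLetter w e) := by
  have h1 : ∏ T : F.ConnectedComponent, ((T.supp.ncard - 1)! : ℝ) = 1 := by
    refine Finset.prod_eq_one fun T _ => ?_
    rw [← card_edges_component hF.acyclic, Nat.factorial_eq_one.2, Nat.cast_one]
    rw [Finset.card_le_one]
    intro e he e' he'
    simp only [Finset.mem_filter, SimpleGraph.mem_edgeFinset] at he he'
    refine hd e he.1 e' he'.1 _ (out_fst_mem e) _ (out_fst_mem e') ?_
    exact hF.sameLetter _ _ (SimpleGraph.ConnectedComponent.exact (he.2.trans he'.2.symm))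
  rw [hF.forestWeight_eq, h1, div_one]

/-- Two edges with a common vertex share a letter there and so coincide; a walk can never leave its
first edge. -/
lemma HasDistinctEdgeLetters.reachable_iff (hd : HasDistinctEdgeLetters w F)
    {i j : Fin w.length} :
    F.Reachable i j ↔ i = j ∨ F.Adj i j := by
  constructor
  · rw [SimpleGraph.reachable_iff_reflTransGen]
    intro h
    induction h with
    | refl => exact Or.inl rfl
    | @tail b c _ hbc ih =>
      rcases ih with rfl | h
      · exact Or.inr hbc
      · have := hd s(i, b) h s(b, c) hbc b (by simp) b (by simp) rfl
        rw [Sym2.eq_swap, Sym2.congr_right] at this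
        exact Or.inl this
  · rintro (rfl | h)
    · rfl
    · exact h.reachable

/-- A graph whose edges have different letters is a non-crossing forest if and only if every edge
connects two equal letters and no two edges cross. -/
lemma HasDistinctEdgeLetters.isNoncrossingForest_iff (hd : HasDistinctEdgeLetters w F) :
    IsNoncrossingForest w F ↔ (∀ i j, F.Adj i j → letterAt w i = letterAt w j) ∧
      ∀ i j k l, i < j → j < k → k < l → F.Adj i k → ¬ F.Adj j l := by
  constructor
  · intro hF
    have hl : ∀ i j, F.Adj i j → letterAt w i = letterAt w j :=
      fun i j h => hF.sameLetter i j h.reachable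
    refine ⟨hl, fun i j k l hij hjk hkl hik hjl => ?_⟩
    have h := hl i j
    have hr := hF.noncrossing i j k l hij hjk hkl hik.reachable hjl.reachable
    have := hd s(i, k) hik s(j, l) hjl i (by simp) j (by simp) (hF.sameLetter _ _ hr)
    simp only [Sym2.eq_iff] at this
    omega
  · rintro ⟨hl, hc⟩
    refine ⟨?_, ?_, ?_⟩
    -- Deleting an edge keeps the letters distinct, so its ends could only stay connected by being
    -- adjacent. Every edge is thus a bridge.
    · rw [SimpleGraph.isAcyclic_iff_forall_isBridge]
      intro e he
      induction e with
      | h a b =>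
        have hab : F.Adj a b := he
        rw [SimpleGraph.isBridge_iff]
        have hd' : HasDistinctEdgeLetters w (F.deleteEdges {s(a, b)}) := by
          intro e he e' he'
          exact hd e (SimpleGraph.edgeSet_mono (SimpleGraph.deleteEdges_le _) he) e'
            (SimpleGraph.edgeSet_mono (SimpleGraph.deleteEdges_le _) he')
        rw [hd'.reachable_iff]
        rintro (h | h)
        · exact hab.ne h
        · simp at h
    · intro i j h
      rcases hd.reachable_iff.1 h with rfl | h
      · rfl
      · exact hl _ _ h
    · intro i j k l hij hjk hkl hik hjl
      rcases hd.reachable_iff.1 hik with h | hik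
      · omega
      rcases hd.reachable_iff.1 hjl with h | hjl
      · omega
      exact absurd hjl (hc i j k l hij hjk hkl hik)

end Weights

/-! ### Forests on subwords -/

section Subword

variable {β γ : Type*} {u : List (γ × Bool)} {v : List (β × Bool)}

open Classical in
/-- If `u` consists of the positions of `v` whose letters lie in `S`, up to renaming letters, then
`qHat u` is the part of `qHat v` coming from the forests whose edges have letters in `S`. -/
lemma qHat_eq_sum_of_embedding (f : Fin u.length ↪o Fin v.length) (S : Set β)
    (hletter : ∀ i j, letterAt u i = letterAt u j ↔ letterAt v (f i) = letterAt v (f j))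
    (hsign : ∀ i, signAt u i = signAt v (f i))
    (hrange : ∀ j, j ∈ Set.range f ↔ letterAt v j ∈ S) :
    qHat u = ∑ F ∈ ((noncrossingForests v).filter (HasDistinctEdgeLetters v)).filter
      (fun F => ∀ e ∈ F.edgeSet, edgeLetter v e ∈ S), (-1 : ℝ) ^ (equalSignEdges v F).ncard := by
  have hmapedge (G : SimpleGraph (Fin u.length)) :
      (G.map f.toEmbedding).edgeSet = Sym2.map f '' G.edgeSet := by
    ext e
    induction e with
    | h a b =>
      simp only [SimpleGraph.mem_edgeSet, SimpleGraph.map_adj, Set.mem_image]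
      constructor
      · rintro ⟨a', b', h, rfl, rfl⟩
        exact ⟨s(a', b'), h, rfl⟩
      · rintro ⟨e', he', h⟩
        induction e' with
        | h a' b' =>
          simp only [Sym2.map_mk, Sym2.eq_iff] at h
          rcases h with ⟨rfl, rfl⟩ | ⟨rfl, rfl⟩
          · exact ⟨a', b', he', rfl, rfl⟩
          · exact ⟨b', a', SimpleGraph.Adj.symm he', rfl, rfl⟩
  have hdist (G : SimpleGraph (Fin u.length)) :
      HasDistinctEdgeLetters v (G.map f.toEmbedding) ↔ HasDistinctEdgeLetters u G := by
    unfold HasDistinctEdgeLetters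
    rw [hmapedge]
    simp only [Set.forall_mem_image, Sym2.mem_map, forall_exists_index, and_imp,
      forall_apply_eq_imp_iff₂, ← hletter, (Sym2.map.injective f.injective).eq_iff]
  have hsgn (G : SimpleGraph (Fin u.length)) :
      (equalSignEdges v (G.map f.toEmbedding)).ncard = (equalSignEdges u G).ncard := by
    rw [← Set.ncard_image_of_injective _ (Sym2.map.injective f.injective)]
    congr 1
    ext e
    simp only [equalSignEdges, hmapedge, Set.mem_ofPred_eq, Set.mem_image]
    constructor
    · rintro ⟨⟨e, he, rfl⟩, h⟩
      refine ⟨e, ⟨he, fun a ha b hb => ?_⟩, rfl⟩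
      rw [hsign, hsign]
      exact h _ (Sym2.mem_map.2 ⟨a, ha, rfl⟩) _ (Sym2.mem_map.2 ⟨b, hb, rfl⟩)
    · rintro ⟨e, ⟨he, h⟩, rfl⟩
      refine ⟨⟨e, he, rfl⟩, fun a ha b hb => ?_⟩
      obtain ⟨a, ha', rfl⟩ := Sym2.mem_map.1 ha
      obtain ⟨b, hb', rfl⟩ := Sym2.mem_map.1 hb
      rw [← hsign, ← hsign]
      exact h a ha' b hb'
  -- With distinct edge letters, the forest property is local: equal letters along edges and no
  -- crossing edges. An order embedding respects both.
  have hforest (G : SimpleGraph (Fin u.length)) (hd : HasDistinctEdgeLetters u G) :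
      IsNoncrossingForest v (G.map f.toEmbedding) ↔ IsNoncrossingForest u G := by
    rw [((hdist G).2 hd).isNoncrossingForest_iff, hd.isNoncrossingForest_iff]
    constructor
    · rintro ⟨h1, h2⟩
      refine ⟨fun i j h => (hletter i j).2 (h1 _ _ ?_), fun i j k l hij hjk hkl hik hjl =>
        h2 (f i) (f j) (f k) (f l) (by simpa) (by simpa) (by simpa) ?_ ?_⟩
      · exact (SimpleGraph.map_adj_apply (f := f.toEmbedding)).2 h
      · exact (SimpleGraph.map_adj_apply (f := f.toEmbedding)).2 hik
      · exact (SimpleGraph.map_adj_apply (f := f.toEmbedding)).2 hjl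
    · rintro ⟨h1, h2⟩
      refine ⟨fun i j h => ?_, fun i j k l hij hjk hkl hik hjl => ?_⟩
      · obtain ⟨i, j, h', rfl, rfl⟩ := (SimpleGraph.map_adj _ _ _ _).1 h
        exact (hletter i j).1 (h1 _ _ h')
      · obtain ⟨i, k, hik', rfl, rfl⟩ := (SimpleGraph.map_adj _ _ _ _).1 hik
        obtain ⟨j, l, hjl', rfl, rfl⟩ := (SimpleGraph.map_adj _ _ _ _).1 hjl
        exact h2 i j k l (f.lt_iff_lt.1 hij) (f.lt_iff_lt.1 hjk) (f.lt_iff_lt.1 hkl) hik' hjl'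
  -- Both ends of an edge carry its letter, which lies in `S`, so no edge of `F` leaves the range of
  -- `f`.
  have hmapcomap (F : SimpleGraph (Fin v.length)) (hF : IsNoncrossingForest v F)
      (hS : ∀ e ∈ F.edgeSet, edgeLetter v e ∈ S) :
      (F.comap f.toEmbedding).map f.toEmbedding = F := by
    ext a b
    rw [SimpleGraph.map_adj]
    constructor
    · rintro ⟨a, b, h, rfl, rfl⟩
      exact h
    · intro h
      have hab := hS s(a, b) h
      obtain ⟨a', rfl⟩ := (hrange a).2 (hF.edgeLetter_eq (e := s(a, b)) h (Sym2.mem_mk_left a b) ▸ hab)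
      obtain ⟨b', rfl⟩ := (hrange b).2 (hF.edgeLetter_eq (e := s(f a', b)) h (Sym2.mem_mk_right _ b) ▸ hab)
      exact ⟨a', b', h, rfl, rfl⟩
  unfold qHat
  refine Finset.sum_bij' (fun G _ => G.map f.toEmbedding) (fun F _ => F.comap f.toEmbedding)
    ?_ ?_ ?_ ?_ ?_
  · intro G hG
    simp only [noncrossingForests, Finset.mem_filter, Finset.mem_univ, true_and] at hG ⊢
    refine ⟨⟨(hforest G hG.2).2 hG.1, (hdist G).2 hG.2⟩, ?_⟩
    intro e he
    have hm := out_fst_mem e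
    rw [hmapedge] at he
    obtain ⟨e', -, rfl⟩ := he
    obtain ⟨a, -, ha⟩ := Sym2.mem_map.1 hm
    exact (hrange _).1 ⟨a, ha⟩
  · intro F hF
    simp only [noncrossingForests, Finset.mem_filter, Finset.mem_univ, true_and] at hF ⊢
    have h := hmapcomap F hF.1.1 hF.2
    have hd : HasDistinctEdgeLetters u (F.comap f.toEmbedding) := by
      rw [← hdist, h]
      exact hF.1.2
    refine ⟨?_, hd⟩
    rw [← hforest _ hd, h]
    exact hF.1.1
  · intro G _
    exact SimpleGraph.comap_map_eq _ _
  · intro F hF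
    simp only [noncrossingForests, Finset.mem_filter, Finset.mem_univ, true_and] at hF
    exact hmapcomap F hF.1.1 hF.2
  · intro G _
    rw [hsgn]

end Subword

/-! ### Split words and selection of pieces -/

section SplitWord

variable {α : Type*} {w : List (α × Bool)} {N : α → ℕ}

lemma mem_splitLetter {c : α × Bool} {p : (α × ℕ) × Bool} :
    p ∈ splitLetter N c ↔ p.1.1 = c.1 ∧ p.1.2 < N c.1 ∧ p.2 = c.2 := by
  obtain ⟨a, _ | _⟩ := c <;> obtain ⟨⟨b, i⟩, ε⟩ := p <;>
    simp only [splitLetter, List.mem_reverse, List.mem_map, List.mem_range, Prod.mk.injEq] <;>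
    aesop

lemma mem_splitWord {p : (α × ℕ) × Bool} :
    p ∈ splitWord N w ↔ (p.1.1, p.2) ∈ w ∧ p.1.2 < N p.1.1 := by
  simp only [splitWord, List.mem_flatMap, mem_splitLetter]
  constructor
  · rintro ⟨⟨a, ε⟩, h, h1, h2, h3⟩
    simp only at h1 h2 h3
    subst h1 h3
    exact ⟨h, h2⟩
  · rintro ⟨h, h2⟩
    exact ⟨_, h, rfl, h2, rfl⟩

lemma letterAt_splitWord_snd_lt (i : Fin (splitWord N w).length) :
    (letterAt (splitWord N w) i).2 < N (letterAt (splitWord N w) i).1 := by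
  have h := List.get_mem (splitWord N w) i
  rw [mem_splitWord] at h
  exact h.2

lemma letterAt_splitWord_fst_mem (i : Fin (splitWord N w).length) :
    (letterAt (splitWord N w) i).1 ∈ w.map Prod.fst := by
  have h := List.get_mem (splitWord N w) i
  rw [mem_splitWord] at h
  exact List.mem_map.2 ⟨_, h.1, rfl⟩

lemma length_splitLetter (c : α × Bool) : (splitLetter N c).length = N c.1 := by
  obtain ⟨a, _ | _⟩ := c <;> simp [splitLetter]

lemma length_splitWord : (splitWord N w).length = (w.map fun c => N c.1).sum := by
  simp [splitWord, List.length_flatMap, length_splitLetter]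

lemma nodup_splitLetter (c : α × Bool) : (splitLetter N c).Nodup := by
  have h (a : α) (ε : Bool) : ((List.range (N a)).map fun i => ((a, i), ε)).Nodup :=
    List.nodup_range.map fun i j h => by simpa using h
  obtain ⟨a, _ | _⟩ := c
  · exact List.nodup_reverse.2 (h a false)
  · exact h a true

lemma splitWord_congr {N' : α → ℕ} (h : ∀ c ∈ w, N c.1 = N' c.1) :
    splitWord N w = splitWord N' w := by
  refine List.flatMap_congr fun c hc => ?_
  obtain ⟨a, _ | _⟩ := c <;> simp [splitLetter, h _ hc]

lemma length_eq_card_filter {γ : Type*} (v : List γ) (p : γ → Bool) :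
    (v.filter p).length = (Finset.univ.filter fun i => p (v.get i) = true).card := by
  have h : (Finset.univ : Finset (Fin v.length)).val.map v.get = v := by
    rw [Fin.univ_val_map, List.ofFn_get]
  have h2 : (v.filter p).length = (Multiset.filter (fun x => p x = true) (v : Multiset γ)).card := by
    simp
  rw [h2, ← h, Multiset.filter_map, Multiset.card_map]
  rfl

open Classical in
/-- Each letter of a split word occurs at most as often as there are positions in the word. -/
lemma card_letterAt_splitWord_le (b : α × ℕ) :
    (Finset.univ.filter fun i => letterAt (splitWord N w) i = b).card ≤ w.length := by
  have h := length_eq_card_filter (splitWord N w) (fun p => decide (p.1 = b))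
  simp only [decide_eq_true_eq] at h
  rw [show (Finset.univ.filter fun i => letterAt (splitWord N w) i = b) =
    (Finset.univ.filter fun i => ((splitWord N w).get i).1 = b) from rfl, ← h]
  clear h
  induction w with
  | nil => simp [splitWord]
  | cons c w ih =>
    rw [splitWord, List.flatMap_cons, List.filter_append, List.length_append, List.length_cons,
      add_comm]
    refine Nat.add_le_add ih ?_
    have hn := (nodup_splitLetter (N := N) c).filter (fun p => decide (p.1 = b))
    -- Within one block the sign is fixed, so two occurrences of `b` would be equal entries of a
    -- list without duplicates.
    by_contra! hlt
    rw [List.nodup_iff_injective_get] at hn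
    have := @hn ⟨0, by omega⟩ ⟨1, by omega⟩ ?_
    · simp at this
    · have key : ∀ p ∈ (splitLetter N c).filter (fun p => decide (p.1 = b)), p = (b, c.2) := by
        intro p hp
        rw [List.mem_filter, mem_splitLetter] at hp
        exact Prod.ext (by simpa using hp.2) hp.1.2.2
      rw [key _ (List.get_mem _ _), key _ (List.get_mem _ _)]

open Classical in
/-- The `i`-th element of `s ∩ {0, …, J - 1}`. -/
noncomputable def nthElement (J : ℕ) (s : Finset ℕ) (i : ℕ) : ℕ :=
  ((List.range J).filter (· ∈ s)).getD i 0

open Classical in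
lemma length_filter_range {J : ℕ} {s : Finset ℕ} (hs : s ⊆ Finset.range J) :
    ((List.range J).filter (· ∈ s)).length = s.card := by
  rw [← List.toFinset_card_of_nodup (List.nodup_range.filter _)]
  congr 1
  ext i
  simpa using fun h => by simpa using hs h

open Classical in
lemma map_nthElement {J : ℕ} {s : Finset ℕ} (hs : s ⊆ Finset.range J) :
    (List.range s.card).map (nthElement J s) = (List.range J).filter (· ∈ s) := by
  refine List.ext_getElem (by simp [length_filter_range hs]) fun i h1 h2 => ?_
  simp [nthElement, h2]

lemma nthElement_injOn {J : ℕ} {s : Finset ℕ} (hs : s ⊆ Finset.range J) {i j : ℕ}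
    (hi : i < s.card) (hj : j < s.card) (h : nthElement J s i = nthElement J s j) : i = j := by
  classical
  rw [← length_filter_range hs] at hi hj
  rw [nthElement, nthElement, List.getD_eq_getElem _ _ hi, List.getD_eq_getElem _ _ hj] at h
  exact ((List.nodup_range.filter _).getElem_inj_iff).1 h

-- `nthElement` enumerates `s a` increasingly, so renaming preserves the order within a block; for
-- inverse letters both sides are reversed alike.
open Classical in
lemma map_splitWord_eq_filter {J : ℕ} {s : α → Finset ℕ} (hs : ∀ a, s a ⊆ Finset.range J) :
    (splitWord (fun a => (s a).card) w).map
        (fun p => ((p.1.1, nthElement J (s p.1.1) p.1.2), p.2)) =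
      (splitWord (fun _ => J) w).filter (fun p => p.1.2 ∈ s p.1.1) := by
  simp only [splitWord, List.map_flatMap, List.filter_flatMap]
  refine List.flatMap_congr fun c _ => ?_
  have h (a : α) (ε : Bool) : ((List.range (s a).card).map fun i => ((a, i), ε)).map
        (fun p => ((p.1.1, nthElement J (s p.1.1) p.1.2), p.2)) =
      ((List.range J).map fun i => ((a, i), ε)).filter (fun p => p.1.2 ∈ s p.1.1) := by
    rw [List.filter_map, List.map_map]
    have := congrArg (List.map fun i => ((a, i), ε)) (map_nthElement (hs a))
    rw [List.map_map] at this
    exact this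
  obtain ⟨a, _ | _⟩ := c
  · simp only [splitLetter, List.map_reverse, List.filter_reverse]
    rw [h]
  · exact h a true

open Classical in
lemma qHat_eq_sum_of_map_eq_filter {β γ : Type*} {u : List (γ × Bool)} {v : List (β × Bool)}
    (g : γ → β) (S : Set β)
    (hmap : u.map (fun p => (g p.1, p.2)) = v.filter (fun p => p.1 ∈ S))
    (hg : ∀ i j, g (letterAt u i) = g (letterAt u j) → letterAt u i = letterAt u j) :
    qHat u = ∑ F ∈ ((noncrossingForests v).filter (HasDistinctEdgeLetters v)).filter
      (fun F => ∀ e ∈ F.edgeSet, edgeLetter v e ∈ S), (-1 : ℝ) ^ (equalSignEdges v F).ncard := by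
  obtain ⟨f₀, hf₀⟩ := List.sublist_iff_exists_fin_orderEmbedding_get_eq.1
    (show List.Sublist (u.map fun p => (g p.1, p.2)) v from hmap ▸ List.filter_sublist)
  have hlen : u.length = (u.map fun p => (g p.1, p.2)).length := by simp
  let f : Fin u.length ↪o Fin v.length := (Fin.castOrderIso hlen).toOrderEmbedding.trans f₀
  have hf (i : Fin u.length) : v.get (f i) = (g (u.get i).1, (u.get i).2) := by
    have := hf₀ (Fin.cast hlen i)
    rw [show v.get (f i) = v.get (f₀ (Fin.cast hlen i)) from rfl, ← this]
    simp
  -- The sublist embedding lands in the positions with letter in `S`; equal cardinality makes it hit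
  -- all of them.
  have himage : Finset.univ.image f =
      Finset.univ.filter fun j => decide ((v.get j).1 ∈ S) = true := by
    refine Finset.eq_of_subset_of_card_le ?_ ?_
    · intro j hj
      obtain ⟨i, -, rfl⟩ := Finset.mem_image.1 hj
      have : (g (u.get i).1, (u.get i).2) ∈ u.map fun p => (g p.1, p.2) :=
        List.mem_map.2 ⟨_, List.get_mem u i, rfl⟩
      rw [hmap, List.mem_filter, ← hf] at this
      simpa using this.2
    · rw [Finset.card_image_of_injective _ f.injective, Finset.card_univ, Fintype.card_fin, hlen,
        hmap, length_eq_card_filter]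
  have hfl (i : Fin u.length) : letterAt v (f i) = g (letterAt u i) := congrArg Prod.fst (hf i)
  refine qHat_eq_sum_of_embedding f S ?_ (fun i => (congrArg Prod.snd (hf i)).symm) fun j => ?_
  · intro i j
    rw [hfl, hfl]
    exact ⟨congrArg g, hg i j⟩
  · have := congrArg (j ∈ ·) himage
    simpa [letterAt] using this

open Classical in
lemma qHat_splitWord_eq_sum {J : ℕ} {s : α → Finset ℕ} (hs : ∀ a, s a ⊆ Finset.range J)
    {S : Set (α × ℕ)} (hS : ∀ b, b ∈ S ↔ b.2 ∈ s b.1) :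
    qHat (splitWord (fun a => (s a).card) w) =
      ∑ F ∈ ((noncrossingForests (splitWord (fun _ => J) w)).filter
          (HasDistinctEdgeLetters (splitWord (fun _ => J) w))).filter
        (fun F => ∀ e ∈ F.edgeSet, edgeLetter (splitWord (fun _ => J) w) e ∈ S),
      (-1 : ℝ) ^ (equalSignEdges (splitWord (fun _ => J) w) F).ncard := by
  refine qHat_eq_sum_of_map_eq_filter (fun b => (b.1, nthElement J (s b.1) b.2)) _
    ((map_splitWord_eq_filter hs).trans (List.filter_congr fun p _ => ?_)) fun i j h => ?_
  · exact decide_eq_decide.2 (hS p.1).symm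
  have hj := letterAt_splitWord_snd_lt j
  rw [Prod.ext_iff] at h ⊢
  obtain ⟨h1, h2⟩ := h
  simp only at h1 h2
  refine ⟨h1, nthElement_injOn (hs _) (letterAt_splitWord_snd_lt i) (h1 ▸ hj) ?_⟩
  rw [h2, h1]

end SplitWord

/-- The binomial theorem over the sets between `B` and `P`. -/
lemma sum_powerset_superset {ι : Type*} [DecidableEq ι] {P B : Finset ι} (hB : B ⊆ P) (x z : ℝ) :
    ∑ E ∈ P.powerset, (if B ⊆ E then x ^ E.card * z ^ (P.card - E.card) else 0) =
      x ^ B.card * (x + z) ^ (P.card - B.card) := by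
  -- Replacing `z` by 0 on `B` kills exactly the sets `E` that miss an element of `B`.
  have h := Finset.prod_add (fun _ => x) (fun i => if i ∈ B then 0 else z) P
  have h1 : ∏ i ∈ P, (x + if i ∈ B then 0 else z) =
      x ^ B.card * (x + z) ^ (P.card - B.card) := by
    rw [← Finset.prod_sdiff hB, mul_comm, ← Finset.card_sdiff_of_subset hB, ← Finset.prod_const,
      ← Finset.prod_const]
    congr 1
    · exact Finset.prod_congr rfl fun i hi => by simp [hi]
    · exact Finset.prod_congr rfl fun i hi => by simp [(Finset.mem_sdiff.1 hi).2]
  rw [← h1, h]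
  refine Finset.sum_congr rfl fun E hE => ?_
  rw [Finset.mem_powerset] at hE
  split_ifs with hBE
  · have h2 : ∏ i ∈ P \ E, (if i ∈ B then 0 else z) = ∏ i ∈ P \ E, z :=
      Finset.prod_congr rfl fun i hi => if_neg fun hi' => (Finset.mem_sdiff.1 hi).2 (hBE hi')
    rw [h2, Finset.prod_const, Finset.prod_const, Finset.card_sdiff_of_subset hE]
  · obtain ⟨i, hi, hiE⟩ := Finset.not_subset.1 hBE
    have h2 : ∏ i ∈ P \ E, (if i ∈ B then 0 else z) = 0 :=
      Finset.prod_eq_zero (Finset.mem_sdiff.2 ⟨hB hi, hiE⟩) (if_pos hi)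
    rw [h2, mul_zero]

/-! ### Binomial averaging -/

section Expansion

variable {α : Type*}

/-- The probability of `k` successes in `J` trials with success probability `y`. -/
noncomputable def binomialWeight (J : ℕ) (y : ℝ) (k : ℕ) : ℝ :=
  J.choose k * y ^ k * (1 - y) ^ (J - k)

/-- Extension of a family indexed by a finite set of letters by a default value. -/
noncomputable def extendDefault {A : Finset α} {γ : Type*} (c : γ) (n : A → γ) (a : α) : γ :=
  open Classical in if h : a ∈ A then n ⟨a, h⟩ else c

lemma extendDefault_of_mem {A : Finset α} {γ : Type*} (c : γ) (n : A → γ) {a : α} (h : a ∈ A) :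
    extendDefault c n a = n ⟨a, h⟩ := by
  rw [extendDefault, dif_pos h]

lemma extendDefault_comp {A : Finset α} {γ δ : Type*} (g : γ → δ) (c : γ) (n : A → γ) (a : α) :
    extendDefault (g c) (fun b => g (n b)) a = g (extendDefault c n a) := by
  rw [extendDefault, extendDefault]
  split_ifs <;> rfl

open Classical in
/-- The contribution to `q` of the split word coming from the forests whose edges have different
letters is a binomial average of `qHat`. -/
lemma sum_hasDistinctEdgeLetters_eq (w : List (α × Bool)) (A : Finset α)
    (hA : ∀ a ∈ w.map Prod.fst, a ∈ A) (J : ℕ) (y : α → ℝ) :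
    ∑ F ∈ (noncrossingForests (splitWord (fun _ => J) w)).filter
        (HasDistinctEdgeLetters (splitWord (fun _ => J) w)),
      forestWeight (splitWord (fun _ => J) w) F (fun b => y b.1) =
    ∑ n ∈ Fintype.piFinset (fun _ : A => Finset.range (J + 1)),
      (∏ a : A, binomialWeight J (y a) (n a)) * qHat (splitWord (extendDefault 0 n) w) := by
  generalize hv : splitWord (fun _ => J) w = v
  have hlet (i : Fin v.length) : (letterAt v i).1 ∈ A ∧ (letterAt v i).2 < J := by
    subst hv
    exact ⟨hA _ (letterAt_splitWord_fst_mem i), letterAt_splitWord_snd_lt i⟩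
  have hlete (e : Sym2 (Fin v.length)) : (edgeLetter v e).1 ∈ A ∧ (edgeLetter v e).2 < J :=
    hlet _
  -- `B F a` is the set of pieces of `a` used by edges of `F`; distinct letters make its size the
  -- number of those edges.
  let B (F : SimpleGraph (Fin v.length)) (a : A) : Finset ℕ :=
    (F.edgeFinset.filter fun e => (edgeLetter v e).1 = a).image fun e => (edgeLetter v e).2
  have hBJ (F : SimpleGraph (Fin v.length)) (a : A) : B F a ⊆ Finset.range J := by
    intro i hi
    obtain ⟨e, -, rfl⟩ := Finset.mem_image.1 hi
    exact Finset.mem_range.2 (hlet _).2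
  have hcard (F : SimpleGraph (Fin v.length)) (hd : HasDistinctEdgeLetters v F) (a : A) :
      (B F a).card = (F.edgeFinset.filter fun e => (edgeLetter v e).1 = a).card := by
    refine Finset.card_image_of_injOn fun e he e' he' h => ?_
    simp only [Finset.coe_filter, SimpleGraph.mem_edgeFinset, Set.mem_ofPred_eq] at he he'
    exact hd e he.1 e' he'.1 _ (out_fst_mem e) _ (out_fst_mem e')
      (Prod.ext (he.2.trans he'.2.symm) h)
  -- For `0 ≤ y a ≤ 1` this is the probability that a random selection `s` contains all used pieces;
  -- as a polynomial identity it holds for every real `y`.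
  have hprod (F : SimpleGraph (Fin v.length)) (hd : HasDistinctEdgeLetters v F) :
      ∏ e ∈ F.edgeFinset, y (edgeLetter v e).1 =
        ∑ s ∈ Fintype.piFinset (fun _ : A => (Finset.range J).powerset),
          if ∀ a, B F a ⊆ s a then ∏ a : A, (y a ^ (s a).card * (1 - y a) ^ (J - (s a).card))
          else 0 := by
    calc ∏ e ∈ F.edgeFinset, y (edgeLetter v e).1
        = ∏ a ∈ A, ∏ e ∈ F.edgeFinset.filter (fun e => (edgeLetter v e).1 = a),
            y (edgeLetter v e).1 :=
          (Finset.prod_fiberwise_of_maps_to (fun e _ => (hlet _).1) _).symm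
      _ = ∏ a : A, y a ^ (B F a).card := by
          rw [← Finset.prod_coe_sort]
          refine Finset.prod_congr rfl fun a _ => ?_
          rw [hcard F hd, ← Finset.prod_const]
          refine Finset.prod_congr rfl fun e he => ?_
          rw [(Finset.mem_filter.1 he).2]
      _ = ∏ a : A, ∑ s ∈ (Finset.range J).powerset,
            if B F a ⊆ s then y a ^ s.card * (1 - y a) ^ (J - s.card) else 0 := by
          refine Finset.prod_congr rfl fun a _ => ?_
          have := sum_powerset_superset (hBJ F a) (y a) (1 - y a)
          simp only [Finset.card_range, add_sub_cancel, one_pow, mul_one] at this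
          exact this.symm
      _ = _ := by
          rw [Finset.prod_univ_sum]
          refine Finset.sum_congr rfl fun s _ => ?_
          split_ifs with h
          · exact Finset.prod_congr rfl fun a _ => if_pos (h a)
          · push Not at h
            obtain ⟨a, ha⟩ := h
            exact Finset.prod_eq_zero (Finset.mem_univ a) (if_neg ha)
  have hq (s : A → Finset ℕ) (hs : s ∈ Fintype.piFinset fun _ : A => (Finset.range J).powerset) :
      ∑ F ∈ (noncrossingForests v).filter (HasDistinctEdgeLetters v),
        (if ∀ a, B F a ⊆ s a then (-1 : ℝ) ^ (equalSignEdges v F).ncard else 0) =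
      qHat (splitWord (extendDefault 0 fun a => (s a).card) w) := by
    have hs' (a : α) : extendDefault ∅ s a ⊆ Finset.range J := by
      rw [extendDefault]
      split_ifs with h
      · exact Finset.mem_powerset.1 (Fintype.mem_piFinset.1 hs _)
      · exact Finset.empty_subset _
    obtain ⟨S, hS⟩ : ∃ S : Set (α × ℕ), ∀ b, b ∈ S ↔ b.2 ∈ extendDefault ∅ s b.1 :=
      ⟨{b | b.2 ∈ extendDefault ∅ s b.1}, fun _ => Iff.rfl⟩
    have h := qHat_splitWord_eq_sum (w := w) hs' hS
    rw [hv] at h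
    have h2 : (extendDefault 0 fun a => (s a).card) = fun a => (extendDefault ∅ s a).card := by
      funext a
      exact extendDefault_comp Finset.card ∅ s a
    rw [h2, h, ← Finset.sum_filter]
    refine Finset.sum_congr (Finset.filter_congr fun F _ => ?_) fun _ _ => rfl
    constructor
    · intro hB e he
      rw [hS, extendDefault_of_mem _ _ (hlete e).1]
      refine hB ⟨_, (hlete e).1⟩ (Finset.mem_image.2 ⟨e, Finset.mem_filter.2 ⟨?_, rfl⟩, rfl⟩)
      exact SimpleGraph.mem_edgeFinset.2 he
    · intro hE a i hi
      obtain ⟨e, he, rfl⟩ := Finset.mem_image.1 hi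
      rw [Finset.mem_filter, SimpleGraph.mem_edgeFinset] at he
      have := hE e he.1
      rw [hS, extendDefault_of_mem _ _ (hlete e).1] at this
      convert this
      exact he.2.symm
  calc ∑ F ∈ (noncrossingForests v).filter (HasDistinctEdgeLetters v),
        forestWeight v F (fun b => y b.1)
      = ∑ F ∈ (noncrossingForests v).filter (HasDistinctEdgeLetters v),
          ∑ s ∈ Fintype.piFinset (fun _ : A => (Finset.range J).powerset),
            (∏ a : A, (y a ^ (s a).card * (1 - y a) ^ (J - (s a).card))) *
              if ∀ a, B F a ⊆ s a then (-1 : ℝ) ^ (equalSignEdges v F).ncard else 0 := by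
        refine Finset.sum_congr rfl fun F hF => ?_
        simp only [noncrossingForests, Finset.mem_filter, Finset.mem_univ, true_and] at hF
        rw [hF.1.forestWeight_of_hasDistinctEdgeLetters hF.2, hprod F hF.2, Finset.mul_sum]
        refine Finset.sum_congr rfl fun s _ => ?_
        split_ifs
        · exact mul_comm _ _
        · simp
    _ = ∑ s ∈ Fintype.piFinset (fun _ : A => (Finset.range J).powerset),
          (∏ a : A, (y a ^ (s a).card * (1 - y a) ^ (J - (s a).card))) *
            qHat (splitWord (extendDefault 0 fun a => (s a).card) w) := by
        rw [Finset.sum_comm]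
        refine Finset.sum_congr rfl fun s hs => ?_
        rw [← Finset.mul_sum, hq s hs]
    _ = ∑ n ∈ Fintype.piFinset (fun _ : A => Finset.range (J + 1)),
          ∑ s ∈ (Fintype.piFinset (fun _ : A => (Finset.range J).powerset)).filter
            (fun s => (fun a => (s a).card) = n),
          (∏ a : A, (y a ^ (s a).card * (1 - y a) ^ (J - (s a).card))) *
            qHat (splitWord (extendDefault 0 fun a => (s a).card) w) := by
        refine (Finset.sum_fiberwise_of_maps_to (fun s hs => ?_) _).symm
        rw [Fintype.mem_piFinset] at hs ⊢
        intro a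
        have := Finset.card_le_card (Finset.mem_powerset.1 (hs a))
        rw [Finset.card_range] at this
        exact Finset.mem_range.2 (by omega)
    _ = _ := by
        refine Finset.sum_congr rfl fun n _ => ?_
        -- The summand depends on `s` only through cardinalities; the number of selections with
        -- sizes `n` supplies the binomial coefficients.
        have hfib : (Fintype.piFinset (fun _ : A => (Finset.range J).powerset)).filter
            (fun s => (fun a => (s a).card) = n) =
            Fintype.piFinset fun a => (Finset.range J).powersetCard (n a) := by
          ext s
          simp only [Finset.mem_filter, Fintype.mem_piFinset, Finset.mem_powerset,
            Finset.mem_powersetCard, funext_iff, forall_and]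
        rw [hfib, Finset.sum_congr rfl (g := fun _ =>
          (∏ a : A, (y a ^ n a * (1 - y a) ^ (J - n a))) *
            qHat (splitWord (extendDefault 0 n) w)) ?_, Finset.sum_const, Fintype.card_piFinset,
          nsmul_eq_mul, ← mul_assoc]
        · congr 1
          rw [Nat.cast_prod, ← Finset.prod_mul_distrib]
          refine Finset.prod_congr rfl fun a _ => ?_
          rw [Finset.card_powersetCard, Finset.card_range, binomialWeight, mul_assoc]
        · intro s hs
          have : (fun a => (s a).card) = n := by
            funext a
            exact (Finset.mem_powersetCard.1 (Fintype.mem_piFinset.1 hs a)).2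
          subst this
          rfl

end Expansion

/-! ### Counting edges and forests -/

section Bounds

variable {β : Type*}

open Classical in
/-- The positions with the same letter as the position `i`. -/
noncomputable def letterClass (v : List (β × Bool)) (i : Fin v.length) : Finset (Fin v.length) :=
  Finset.univ.filter fun j => letterAt v j = letterAt v i

open Classical in
/-- The pairs of positions that may be edges of a non-crossing forest. -/
noncomputable def sameLetterPairs (v : List (β × Bool)) : Finset (Sym2 (Fin v.length)) :=
  Finset.univ.filter fun e => ∀ i ∈ e, ∀ j ∈ e, letterAt v i = letterAt v j

variable {v : List (β × Bool)} {m : ℕ}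

open Classical in
lemma letterAt_out_eq {e : Sym2 (Fin v.length)} (he : e ∈ sameLetterPairs v) :
    letterAt v (Quot.out e).2 = letterAt v (Quot.out e).1 := by
  rw [sameLetterPairs, Finset.mem_filter] at he
  exact he.2 _ (Sym2.out_snd_mem e) _ (Sym2.out_fst_mem e)

lemma sym2_out_injective {γ : Type*} : Function.Injective (Quot.out : Sym2 γ → γ × γ) :=
  Function.LeftInverse.injective (g := Quot.mk _) Quot.out_eq

open Classical in
lemma card_sameLetterPairs_le (hm : ∀ i, (letterClass v i).card ≤ m) :
    (sameLetterPairs v).card ≤ v.length * m := by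
  calc (sameLetterPairs v).card
      ≤ (Finset.univ.sigma fun i => letterClass v i).card := by
        refine Finset.card_le_card_of_injOn
          (fun e => ⟨(Quot.out e).1, (Quot.out e).2⟩) ?_ ?_
        · intro e he
          simpa [letterClass] using letterAt_out_eq he
        · intro e _ e' _ h
          simp only [Sigma.mk.injEq, heq_eq_eq] at h
          exact sym2_out_injective (Prod.ext h.1 h.2)
    _ ≤ v.length * m := by
        rw [Finset.card_sigma]
        refine (Finset.sum_le_card_nsmul _ _ m fun i _ => hm i).trans ?_
        simp

-- All four endpoints have one letter: the first is free and the other three lie in its class of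
-- size at most `m`.
open Classical in
lemma card_pairs_of_sameLetterPairs_le (hm : ∀ i, (letterClass v i).card ≤ m) :
    ((sameLetterPairs v ×ˢ sameLetterPairs v).filter fun p =>
      p.1 ≠ p.2 ∧ edgeLetter v p.1 = edgeLetter v p.2).card ≤ v.length * m ^ 3 := by
  calc _ ≤ (Finset.univ.sigma fun i =>
        letterClass v i ×ˢ (letterClass v i ×ˢ letterClass v i)).card := by
        refine Finset.card_le_card_of_injOn
          (fun p => ⟨(Quot.out p.1).1, (Quot.out p.1).2, (Quot.out p.2).1, (Quot.out p.2).2⟩) ?_ ?_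
        · intro p hp
          simp only [Finset.coe_filter, Finset.mem_product, Set.mem_ofPred_eq] at hp
          obtain ⟨⟨h1, h2⟩, -, h3⟩ := hp
          have h1' := letterAt_out_eq h1
          have h2' := letterAt_out_eq h2
          rw [edgeLetter, edgeLetter] at h3
          simp [letterClass, h1', h2', h3]
        · rintro ⟨e₁, e₂⟩ _ ⟨e₁', e₂'⟩ _ h
          simp only [Sigma.mk.injEq, heq_eq_eq, Prod.mk.injEq] at h
          exact Prod.ext (sym2_out_injective (Prod.ext h.1 h.2.1))
            (sym2_out_injective (Prod.ext h.2.2.1 h.2.2.2))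
    _ ≤ v.length * m ^ 3 := by
        rw [Finset.card_sigma]
        refine (Finset.sum_le_card_nsmul _ _ (m ^ 3) fun i _ => ?_).trans ?_
        · rw [Finset.card_product, Finset.card_product]
          calc _ ≤ m * (m * m) := Nat.mul_le_mul (hm i) (Nat.mul_le_mul (hm i) (hm i))
            _ = m ^ 3 := by ring
        · simp

open Classical in
lemma IsNoncrossingForest.edgeFinset_subset {F : SimpleGraph (Fin v.length)}
    (hF : IsNoncrossingForest v F) : F.edgeFinset ⊆ sameLetterPairs v := by
  intro e he
  rw [SimpleGraph.mem_edgeFinset] at he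
  refine Finset.mem_filter.2 ⟨Finset.mem_univ _, fun i hi j hj => ?_⟩
  rw [← hF.edgeLetter_eq he hi, ← hF.edgeLetter_eq he hj]

open Classical in
lemma card_noncrossingForests_le : (noncrossingForests v).card ≤ 2 ^ (sameLetterPairs v).card := by
  rw [← Finset.card_powerset]
  refine Finset.card_le_card_of_injOn (fun F => F.edgeFinset) ?_ ?_
  · intro F hF
    exact Finset.mem_powerset.2 (Finset.mem_filter.1 hF).2.edgeFinset_subset
  · intro F _ F' _ h
    exact SimpleGraph.edgeFinset_inj.1 h

lemma abs_qHat_le (hm : ∀ i, (letterClass v i).card ≤ m) : |qHat v| ≤ 2 ^ (v.length * m) := by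
  classical
  calc |qHat v| ≤ ∑ F ∈ (noncrossingForests v).filter (HasDistinctEdgeLetters v), (1 : ℝ) := by
        refine (Finset.abs_sum_le_sum_abs _ _).trans (Finset.sum_le_sum fun F _ => ?_)
        simp
    _ ≤ (noncrossingForests v).card := by
        rw [Finset.sum_const, nsmul_eq_mul, mul_one]
        exact_mod_cast Finset.card_filter_le _ _
    _ ≤ 2 ^ (v.length * m) := by
        exact_mod_cast card_noncrossingForests_le.trans
          (Nat.pow_le_pow_right two_pos (card_sameLetterPairs_le hm))

open Classical in
/-- The contribution to `q` of the forests with two edges of the same letter is of second order. -/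
lemma abs_sum_not_hasDistinctEdgeLetters_le (hm : ∀ i, (letterClass v i).card ≤ m)
    {x : β → ℝ} {δ : ℝ} (hx : ∀ b, 0 ≤ x b) (hδ : ∀ i, x (letterAt v i) ≤ δ) (hδ0 : 0 ≤ δ) :
    |∑ F ∈ (noncrossingForests v).filter (fun F => ¬ HasDistinctEdgeLetters v F),
      forestWeight v F x| ≤ v.length * m ^ 3 * (δ ^ 2 * (1 + δ) ^ (v.length * m)) := by
  set P := sameLetterPairs v with hP
  set R := (P ×ˢ P).filter fun p => p.1 ≠ p.2 ∧ edgeLetter v p.1 = edgeLetter v p.2 with hR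
  have hw (F : SimpleGraph (Fin v.length)) (hF : IsNoncrossingForest v F) :
      |forestWeight v F x| ≤ δ ^ F.edgeFinset.card := by
    refine (hF.abs_forestWeight_le hx).trans ?_
    rw [← Finset.prod_const]
    exact Finset.prod_le_prod (fun _ _ => hx _) fun _ _ => hδ _
  -- Union bound over the offending pairs of edges; at least one pair occurs in `F`.
  have hpair (F : SimpleGraph (Fin v.length)) (hF : IsNoncrossingForest v F)
      (hd : ¬ HasDistinctEdgeLetters v F) :
      δ ^ F.edgeFinset.card ≤
        ∑ p ∈ R, if {p.1, p.2} ⊆ F.edgeFinset then δ ^ F.edgeFinset.card else 0 := by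
    unfold HasDistinctEdgeLetters at hd
    push Not at hd
    obtain ⟨e, he, e', he', u, hu, u', hu', h, hne⟩ := hd
    rw [← hF.edgeLetter_eq he hu, ← hF.edgeLetter_eq he' hu'] at h
    rw [← SimpleGraph.mem_edgeFinset] at he he'
    have hmem : (e, e') ∈ R := Finset.mem_filter.2
      ⟨Finset.mem_product.2 ⟨hF.edgeFinset_subset he, hF.edgeFinset_subset he'⟩, hne, h⟩
    refine le_trans (le_of_eq ?_) (Finset.single_le_sum (fun p _ => ?_) hmem)
    · rw [if_pos]
      intro a ha
      rw [Finset.mem_insert, Finset.mem_singleton] at ha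
      rcases ha with rfl | rfl <;> assumption
    · split_ifs
      · positivity
      · exact le_rfl
  calc |∑ F ∈ (noncrossingForests v).filter (fun F => ¬ HasDistinctEdgeLetters v F),
        forestWeight v F x|
      ≤ ∑ F ∈ (noncrossingForests v).filter (fun F => ¬ HasDistinctEdgeLetters v F),
          ∑ p ∈ R, if {p.1, p.2} ⊆ F.edgeFinset then δ ^ F.edgeFinset.card else 0 := by
        refine (Finset.abs_sum_le_sum_abs _ _).trans (Finset.sum_le_sum fun F hF => ?_)
        simp only [noncrossingForests, Finset.mem_filter, Finset.mem_univ, true_and] at hF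
        exact (hw F hF.1).trans (hpair F hF.1 hF.2)
    _ = ∑ p ∈ R, ∑ F ∈ (noncrossingForests v).filter (fun F => ¬ HasDistinctEdgeLetters v F),
          if {p.1, p.2} ⊆ F.edgeFinset then δ ^ F.edgeFinset.card else 0 := Finset.sum_comm
    -- A forest is determined by its edge set, so the sum may be enlarged to all sets of admissible
    -- pairs, where the binomial theorem applies.
    _ ≤ ∑ p ∈ R, ∑ E ∈ P.powerset,
          if {p.1, p.2} ⊆ E then δ ^ E.card * 1 ^ (P.card - E.card) else 0 := by
        refine Finset.sum_le_sum fun p _ => ?_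
        simp only [one_pow, mul_one]
        rw [← Finset.sum_image (s := (noncrossingForests v).filter
          (fun F => ¬ HasDistinctEdgeLetters v F)) (g := fun F => F.edgeFinset)
          (f := fun E => if {p.1, p.2} ⊆ E then δ ^ E.card else 0)]
        · refine Finset.sum_le_sum_of_subset_of_nonneg ?_ fun E _ _ => ?_
          · intro E hE
            obtain ⟨F, hF, rfl⟩ := Finset.mem_image.1 hE
            simp only [noncrossingForests, Finset.mem_filter, Finset.mem_univ, true_and] at hF
            exact Finset.mem_powerset.2 hF.1.edgeFinset_subset
          · split_ifs
            · positivity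
            · exact le_rfl
        · intro F _ F' _ h
          exact SimpleGraph.edgeFinset_inj.1 h
    _ ≤ ∑ p ∈ R, δ ^ 2 * (1 + δ) ^ (v.length * m) := by
        refine Finset.sum_le_sum fun p hp => ?_
        simp only [hR, Finset.mem_filter, Finset.mem_product] at hp
        rw [sum_powerset_superset, Finset.card_pair hp.2.1, add_comm δ]
        · gcongr
          · linarith
          · exact (Nat.sub_le _ _).trans (card_sameLetterPairs_le hm)
        · intro a ha
          rw [Finset.mem_insert, Finset.mem_singleton] at ha
          rcases ha with rfl | rfl
          · exact hp.1.1
          · exact hp.1.2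
    _ ≤ v.length * m ^ 3 * (δ ^ 2 * (1 + δ) ^ (v.length * m)) := by
        rw [Finset.sum_const, nsmul_eq_mul]
        gcongr
        exact_mod_cast card_pairs_of_sameLetterPairs_le hm

end Bounds

/-! ### The Poisson limit -/

section Limit

variable {ι : Type*} [Fintype ι]

/-- A finite product of counting measures on `ℕ` is counting measure, so this is integrability of a
product of one-variable functions. -/
lemma summable_prod_pi {h : ι → ℕ → ℝ} (hh : ∀ i, Summable fun k => ‖h i k‖) :
    Summable fun n : ι → ℕ => ∏ i, h i (n i) := by
  have h1 : Integrable (fun n : ι → ℕ => ∏ i, h i (n i))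
      (Measure.pi fun _ : ι => (Measure.count : Measure ℕ)) :=
    Integrable.fintype_prod fun i => integrable_count_iff.2 (hh i)
  have h2 : (Measure.pi fun _ : ι => (Measure.count : Measure ℕ)) = Measure.count := by
    refine Measure.ext_of_singleton fun n => ?_
    simp [Measure.pi_singleton]
  rw [h2, integrable_count_iff] at h1
  exact h1.of_norm

lemma binomialWeight_nonneg {J : ℕ} {y : ℝ} (h0 : 0 ≤ y) (h1 : y ≤ 1) (k : ℕ) :
    0 ≤ binomialWeight J y k := by
  have : 0 ≤ 1 - y := by linarith
  unfold binomialWeight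
  positivity

lemma binomialWeight_le {J : ℕ} (hJ : 0 < J) {t : ℝ} (h0 : 0 ≤ t) (h1 : t ≤ J) (k : ℕ) :
    binomialWeight J (t / J) k ≤ t ^ k / k ! := by
  have hJ' : (0 : ℝ) < J := by exact_mod_cast hJ
  have hy0 : 0 ≤ t / J := by positivity
  have hy1 : t / J ≤ 1 := (div_le_one hJ').2 h1
  unfold binomialWeight
  calc (J.choose k : ℝ) * (t / J) ^ k * (1 - t / J) ^ (J - k)
      ≤ (J.choose k : ℝ) * (t / J) ^ k * 1 := by
        gcongr
        exact pow_le_one₀ (by linarith) (by linarith)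
    _ ≤ ((J : ℝ) ^ k / k !) * (t / J) ^ k * 1 := by
        gcongr
        exact Nat.choose_le_pow_div k J
    _ = t ^ k / k ! := by
        rw [div_pow]
        field_simp

lemma tendsto_binomialWeight (t : ℝ) (k : ℕ) :
    Tendsto (fun J : ℕ => binomialWeight J (t / J) k) atTop
      (𝓝 (Real.exp (-t) * t ^ k / k !)) := by
  refine tendsto_choose_mul_pow_of_tendsto_mul_atTop (p := fun J : ℕ => t / J) k ?_
  refine tendsto_const_nhds.congr' ?_
  filter_upwards [eventually_gt_atTop 0] with J hJ
  have : (J : ℝ) ≠ 0 := by exact_mod_cast hJ.ne'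
  field_simp

/-- The Poisson limit theorem for averages of functions of exponential growth. -/
lemma tendsto_sum_binomialWeight [DecidableEq ι] {g : (ι → ℕ) → ℝ} {C : ℝ} (hC : 0 ≤ C)
    (hg : ∀ n, |g n| ≤ ∏ i, C ^ n i) (t : ι → ℝ≥0) :
    Tendsto (fun J : ℕ => ∑ n ∈ Fintype.piFinset (fun _ : ι => Finset.range (J + 1)),
      (∏ i, binomialWeight J (t i / J) (n i)) * g n) atTop
      (𝓝 (∑' n, (∏ i, (Real.exp (-t i) * t i ^ n i / (n i)!)) * g n)) := by
  -- The weight vanishes once some `n i > J`, so the index set can be made independent of `J`.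
  have hsum (J : ℕ) : ∑ n ∈ Fintype.piFinset (fun _ : ι => Finset.range (J + 1)),
      (∏ i, binomialWeight J (t i / J) (n i)) * g n =
      ∑' n, (∏ i, binomialWeight J (t i / J) (n i)) * g n := by
    refine (tsum_eq_sum fun n hn => ?_).symm
    rw [Fintype.mem_piFinset] at hn
    push Not at hn
    obtain ⟨i, hi⟩ := hn
    rw [Finset.mem_range, not_lt] at hi
    rw [Finset.prod_eq_zero (Finset.mem_univ i), zero_mul]
    rw [binomialWeight, Nat.choose_eq_zero_of_lt (by omega)]
    simp
  simp_rw [hsum]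
  refine tendsto_tsum_of_dominated_convergence
    (bound := fun n => ∏ i, ((C * t i) ^ n i / (n i)!)) ?_ ?_ ?_
  · refine summable_prod_pi (h := fun i k => (C * t i) ^ k / (k !)) fun i => ?_
    refine (Real.summable_pow_div_factorial (C * t i)).congr fun k => ?_
    rw [Real.norm_of_nonneg (by positivity)]
  · intro n
    exact (tendsto_finsetProd _ fun i _ => tendsto_binomialWeight (t i) (n i)).mul_const _
  -- Once `J` exceeds every parameter, `t i / J` is a probability, and each binomial weight is at
  -- most `t i ^ k / k!`.
  · have hev : ∀ᶠ J : ℕ in atTop, ∀ i, (t i : ℝ) ≤ J :=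
      eventually_all.2 fun i => tendsto_natCast_atTop_atTop.eventually_ge_atTop _
    filter_upwards [hev, eventually_gt_atTop 0] with J hJ hJ0 n
    have hJ' : (0 : ℝ) < J := by exact_mod_cast hJ0
    have h0 (i : ι) : 0 ≤ binomialWeight J (t i / J) (n i) :=
      binomialWeight_nonneg (by positivity) ((div_le_one hJ').2 (hJ i)) _
    rw [norm_mul, Real.norm_of_nonneg (Finset.prod_nonneg fun i _ => h0 i), Real.norm_eq_abs]
    calc (∏ i, binomialWeight J (t i / J) (n i)) * |g n|
        ≤ (∏ i, ((t i : ℝ) ^ n i / (n i)!)) * ∏ i, C ^ n i := by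
          gcongr with i
          · exact fun i _ => h0 i
          · exact binomialWeight_le hJ0 (t i).2 (hJ i) _
          · exact hg n
      _ = ∏ i, ((C * t i) ^ n i / (n i)!) := by
          rw [← Finset.prod_mul_distrib]
          exact Finset.prod_congr rfl fun i _ => by rw [mul_pow]; ring

lemma integrable_pi_poissonMeasure {g : (ι → ℕ) → ℝ} {C : ℝ} (hC : 0 ≤ C)
    (hg : ∀ n, |g n| ≤ ∏ i, C ^ n i) (t : ι → ℝ≥0) :
    Integrable g (Measure.pi fun i => poissonMeasure (t i)) := by
  have h : Integrable (fun n : ι → ℕ => ∏ i, C ^ n i)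
      (Measure.pi fun i => poissonMeasure (t i)) := by
    refine Integrable.fintype_prod (f := fun _ k => C ^ k) fun i => ?_
    rw [integrable_poissonMeasure_iff]
    refine ((Real.summable_pow_div_factorial (C * t i)).mul_left (Real.exp (-t i))).congr
      fun k => ?_
    rw [Real.norm_of_nonneg (by positivity), mul_pow]
    ring
  exact h.mono' Measurable.of_discrete.aestronglyMeasurable (Eventually.of_forall hg)

lemma integral_pi_poissonMeasure {g : (ι → ℕ) → ℝ} {t : ι → ℝ≥0}
    (hg : Integrable g (Measure.pi fun i => poissonMeasure (t i))) :
    ∫ n, g n ∂(Measure.pi fun i => poissonMeasure (t i)) =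
      ∑' n, (∏ i, (Real.exp (-t i) * t i ^ n i / (n i)!)) * g n := by
  rw [integral_countable hg]
  refine tsum_congr fun n => ?_
  rw [measureReal_def, Measure.pi_singleton, ENNReal.toReal_prod, smul_eq_mul]
  congr 1
  exact Finset.prod_congr rfl fun i _ => poissonMeasure_real_singleton (t i) (n i)

end Limit

/-! ### Assembling the limit -/

section Main

variable {α : Type*} {w : List (α × Bool)}

lemma card_letterClass_splitWord_le (N : α → ℕ) (i : Fin (splitWord N w).length) :
    (letterClass (splitWord N w) i).card ≤ w.length := by
  convert card_letterAt_splitWord_le (w := w) (N := N) (letterAt (splitWord N w) i)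
  ext j
  simp [letterClass]

/-- With `L = w.length`, the split word has length at most `L * ∑ n a` and letter classes of size at
most `L`, so `abs_qHat_le` gives the exponent `L * L * ∑ n a`. -/
lemma abs_qHat_splitWord_le {A : Finset α} (hA : ∀ a ∈ w.map Prod.fst, a ∈ A) (n : A → ℕ) :
    |qHat (splitWord (extendDefault 0 n) w)| ≤ ∏ a, ((2 : ℝ) ^ (w.length * w.length)) ^ n a := by
  refine (abs_qHat_le (card_letterClass_splitWord_le _)).trans ?_
  rw [Finset.prod_pow_eq_pow_sum, ← pow_mul]
  refine pow_le_pow_right₀ one_le_two ?_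
  have h : (splitWord (extendDefault 0 n) w).length ≤ w.length * ∑ a, n a := by
    rw [length_splitWord]
    refine (List.sum_le_card_nsmul _ (∑ a, n a) fun k hk => ?_).trans (by simp)
    obtain ⟨c, hc, rfl⟩ := List.mem_map.1 hk
    rw [extendDefault_of_mem _ _ (hA _ (List.mem_map_of_mem hc))]
    exact Finset.single_le_sum (f := n) (fun _ _ => Nat.zero_le _) (Finset.mem_univ _)
  calc _ ≤ w.length * (∑ a, n a) * w.length := Nat.mul_le_mul_right _ h
    _ = _ := by ring

/-- Only finitely many letters occur in `w`, which reduces the possibly infinite product law to a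
finite one. -/
lemma qHat_splitWord_eq_restrict {A : Finset α} (hA : ∀ a ∈ w.map Prod.fst, a ∈ A) (N : α → ℕ) :
    qHat (splitWord N w) = qHat (splitWord (extendDefault 0 (A.restrict N)) w) := by
  rw [splitWord_congr fun c hc => ?_]
  rw [extendDefault_of_mem _ _ (hA _ (List.mem_map_of_mem hc)), Finset.restrict]

open Classical in
lemma tendsto_sum_not_hasDistinctEdgeLetters (w : List (α × Bool)) (t : α → ℝ≥0) :
    Tendsto (fun J : ℕ => ∑ F ∈ (noncrossingForests (splitWord (fun _ => J) w)).filter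
        (fun F => ¬ HasDistinctEdgeLetters (splitWord (fun _ => J) w) F),
      forestWeight (splitWord (fun _ => J) w) F (fun b => t b.1 / J)) atTop (𝓝 0) := by
  set L := w.length with hL
  -- The sum serves as a common bound for the values of all letters of `w`.
  set T : ℝ := ∑ a ∈ (w.map Prod.fst).toFinset, (t a : ℝ) with hT
  have hT0 : 0 ≤ T := Finset.sum_nonneg fun _ _ => (t _).2
  have hlim : Tendsto (fun J : ℕ => (L : ℝ) ^ 4 * T ^ 2 * Real.exp (T * L * L) * (1 / (J : ℝ)))
      atTop (𝓝 0) := by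
    simpa using tendsto_one_div_atTop_nhds_zero_nat.const_mul
      ((L : ℝ) ^ 4 * T ^ 2 * Real.exp (T * L * L))
  refine squeeze_zero_norm' ?_ hlim
  filter_upwards [eventually_gt_atTop 0] with J hJ
  have hJ' : (0 : ℝ) < J := by exact_mod_cast hJ
  have hlen : (splitWord (fun _ => J) w).length = L * J := by
    rw [length_splitWord]
    simp [hL]
  refine (abs_sum_not_hasDistinctEdgeLetters_le (m := L) (δ := T / J)
    (card_letterClass_splitWord_le _) (fun _ => by positivity) (fun i => ?_)
    (by positivity)).trans ?_
  · gcongr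
    exact Finset.single_le_sum (f := fun a => (t a : ℝ)) (fun _ _ => (t _).2)
      (List.mem_toFinset.2 (letterAt_splitWord_fst_mem i))
  -- The number of admissible edges grows linearly in `J`, so this factor stays bounded.
  · have hexp : (1 + T / J) ^ (L * J * L) ≤ Real.exp (T * L * L) := by
      calc (1 + T / J) ^ (L * J * L) ≤ Real.exp (T / J) ^ (L * J * L) := by
            gcongr
            rw [add_comm]
            exact Real.add_one_le_exp _
        _ = Real.exp (T * L * L) := by
            rw [← Real.exp_nat_mul]
            congr 1
            push_cast
            field_simp
    rw [hlen]
    calc ((L * J : ℕ) : ℝ) * L ^ 3 * ((T / J) ^ 2 * (1 + T / J) ^ (L * J * L))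
        ≤ ((L * J : ℕ) : ℝ) * L ^ 3 * ((T / J) ^ 2 * Real.exp (T * L * L)) := by gcongr
      _ = L ^ 4 * T ^ 2 * Real.exp (T * L * L) * (1 / J) := by
          push_cast
          field_simp

lemma integrable_qHat_splitWord_and_tendsto (w : List (α × Bool)) (t : α → ℝ≥0) :
    Integrable (fun N : α → ℕ => qHat (splitWord N w)) (poissonLaw t) ∧
      Tendsto (splitForestSum w fun a => (t a : ℝ)) atTop (𝓝 (poissonForestPolynomial w t)) := by
  classical
  obtain ⟨A, hA⟩ : ∃ A : Finset α, ∀ a ∈ w.map Prod.fst, a ∈ A :=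
    ⟨(w.map Prod.fst).toFinset, fun a ha => List.mem_toFinset.2 ha⟩
  let g : (A → ℕ) → ℝ := fun n => qHat (splitWord (extendDefault 0 n) w)
  have hg (n : A → ℕ) : |g n| ≤ ∏ a, ((2 : ℝ) ^ (w.length * w.length)) ^ n a :=
    abs_qHat_splitWord_le hA n
  have hqg : (fun N : α → ℕ => qHat (splitWord N w)) = g ∘ A.restrict :=
    funext fun N => qHat_splitWord_eq_restrict hA N
  have hmap : (poissonLaw t).map A.restrict = Measure.pi fun a : A => poissonMeasure (t a) :=
    Measure.infinitePi_map_restrict _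
  have hint := integrable_pi_poissonMeasure (by positivity) hg fun a => t a
  have hmeas : Measurable (A.restrict : (α → ℕ) → A → ℕ) := Finset.measurable_restrict A
  have hgm : AEStronglyMeasurable g ((poissonLaw t).map A.restrict) :=
    Measurable.of_discrete.aestronglyMeasurable
  refine ⟨?_, ?_⟩
  · rw [hqg, ← integrable_map_measure hgm hmeas.aemeasurable, hmap]
    exact hint
  · have hval : poissonForestPolynomial w t =
        ∑' n, (∏ a : A, (Real.exp (-t a) * t a ^ n a / (n a)!)) * g n := by
      rw [← integral_pi_poissonMeasure hint, ← hmap, integral_map hmeas.aemeasurable hgm]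
      exact congrArg (fun f => ∫ N, f N ∂(poissonLaw t)) hqg
    rw [hval]
    have h := (tendsto_sum_binomialWeight (by positivity) hg fun a => t a).add
      (tendsto_sum_not_hasDistinctEdgeLetters w t)
    rw [add_zero] at h
    refine h.congr fun J => ?_
    rw [splitForestSum, q, ← sum_hasDistinctEdgeLetters_eq w A hA J (fun a => t a / J)]
    exact Finset.sum_filter_add_sum_filter_not _ _ _

end Main

end ForestPoly

theorem mainTheorem11 {α : Type*} (w : List (α × Bool)) (t : α → ℝ≥0) :
    Integrable (fun N : α → ℕ => ForestPoly.qHat (ForestPoly.splitWord N w))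
      (ForestPoly.poissonLaw t) ∧
    Tendsto (ForestPoly.splitForestSum w fun a => (t a : ℝ)) atTop
      (𝓝 (ForestPoly.forestPolynomial w fun a => (t a : ℝ))) ∧
    ForestPoly.poissonForestPolynomial w t =
      ForestPoly.forestPolynomial w fun a => (t a : ℝ) := by
  obtain ⟨hint, hlim⟩ := ForestPoly.integrable_qHat_splitWord_and_tendsto w t
  -- `limUnder` takes the actual limit here because convergence is already known.
  have h : ForestPoly.poissonForestPolynomial w t =
      ForestPoly.forestPolynomial w fun a => (t a : ℝ) := hlim.limUnder_eq.symm
  exact ⟨hint, h ▸ hlim, h⟩
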